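/- **Setting.** Let $\langle z,w\rangle={}^t\bar z\,\mathbf h\,w$ on $\mathbb C^3$, with $\mathbf h=\begin{pmatrix}0&0&i\\0&1&0\\-i&0&0\end{pmatrix}$, and let $\mathcal S=\{[z]\in\mathbb{CP}^2:\langle z,z\rangle=0\}$, with the contact form $\zeta=-i\langle z,dz\rangle/|z|^2$. The map $(z_1,z_2)\mapsto[\tfrac{1+z_1}2,\tfrac{iz_2}{\sqrt2},\tfrac{i(1-z_1)}2]$ is a diffeomorphism of the unit sphere $S^3\subset\mathbb C^2$ onto $\mathcal S$. A smooth curve $\gamma:\mathbb R\to\mathcal S$ with smooth lift $\Gamma:\mathbb R\to\mathbb C^3\setminus\{0\}$ is (positively) transversal if $\zeta(\gamma')>0$ everywhere, and generic if $\det(\Gamma,\Gamma',\Gamma'')\neq0$ everywhere. A lift with $\det(\Gamma,\Gamma',\Gamma'')=-1$ is a Wilczynski lift, unique up to a cube root of unity; $\gamma$ is a natural parametrization if for such a lift $i\langle\Gamma,\Gamma'\rangle^{-1}=1$, and then its bending and twist are $\kappa=\frac12\langle\Gamma',\Gamma'\rangle$ and $\tau=\mathrm{Im}\langle\Gamma'',\Gamma'\rangle+3\kappa^2$.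 A generic transversal curve, in natural parametrization, is isoparametric if $\kappa,\tau$ are constant; it is an isoparametric knot if moreover it is periodic with minimal period $\omega$ and injective on $[0,\omega)$. Its Hamiltonian is $$H_{\kappa,\tau}=i\begin{pmatrix}i\kappa&-i&\tau\\0&-2i\kappa&1\\1&0&i\kappa\end{pmatrix},$$ whose characteristic polynomial has discriminant $D=-27+108\kappa(\kappa^2+\tau)-324\kappa^4\tau-72\kappa^2\tau^2-4\tau^3$. If $H_{\kappa,\tau}$ has real eigenvalues $e_1<e_2<e_3$, the spectral ratio is $e_1/e_3$. The knot is of the second class if $D>0$ and $3\kappa<|\tau|^{1/2}$. For $\theta_1,\theta_2\in\mathbb R$ let $$R(\theta_1,\theta_2)=\begin{pmatrix}e^{-\frac i6(\theta_1+2\theta_2)}\cos\frac{\theta_1}2&0&e^{-\frac i6(\theta_1+2\theta_2)}\sin\frac{\theta_1}2\\0&e^{\frac i3(\theta_1+2\theta_2)}&0\\-e^{-\frac i6(\theta_1+2\theta_2)}\sin\frac{\theta_1}2&0&e^{-\frac i6(\theta_1+2\theta_2)}\cos\frac{\theta_1}2\end{pmatrix},$$ let $P(\rho)=[1,\rho,\frac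 i2\rho^2]\in\mathcal S$, and let $\mathcal T_\rho=\{R(\theta_1,\theta_2)P(\rho):\theta_1,\theta_2\in\mathbb R\}$ be the standard Heisenberg cyclide. For coprime positive integers $p,q$, a subset of $\mathcal S\cong S^3$ is a positive torus knot of type $(p,q)$ if a smooth ambient isotopy of $S^3$ carries it to $\{(e^{iqt},e^{ipt})/\sqrt2:t\in\mathbb R\}$. For $-2<r<-\frac12$ and $0<\rho<\sqrt2$ put $$N=-4+4r-12\rho^2(1+r)+(r-1)\rho^4,\qquad \mu_2=\frac{N}{N-2\left((2+3r-3r^2-2r^3)(-4\rho+\rho^5)\right)^{2/3}},\qquad m=\frac{\mu_2}{1-\mu_2}.$$ For rational $r$, the symmetrical configuration of the second kind with parameters $(r,\rho)$ is the curve $$\eta_{r,\rho}(s)=\Big(\mathcal U\,\mathrm{Exp}\big(s\,\mathrm{diag}(-im,\;i(1+r)m,\;-irm)\big)\,\mathcal U^{-1}\Big)P(\rho),\qquad \mathcal U=\frac1{\sqrt2}\begin{pmatrix}1&0&i\\0&\sqrt2&0\\i&0&1\end{pmatrix}.$$ **Proposition.** Let $r\in\mathbb Q$ with $-2<r<-\frac12$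 and $\rho\in(0,\sqrt2)$. Then $\eta_{r,\rho}$ is (in natural parametrization) an isoparametric knot of the second class with spectral ratio $r$. Let $p$ and $q$ be the numerator and the denominator of $\frac{2+r}{1-r}$ in lowest terms. Then $p,q>0$ and the trajectory of $\eta_{r,\rho}$ is a positive torus knot of type $(p,q)$. The trajectory is contained in $\mathcal T_\rho$, on which it is the closed curve $\{R(-q\varphi,p\varphi)P(\rho):\varphi\in\mathbb R\}$. -/

import Mathlib

open scoped Matrix ContDiff Manifold LinearAlgebra.Projectivization

namespace CRKnot

/-! ### The pseudo-Hermitian space, the sphere of isotropic lines and its contact form -/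

/-- The Hermitian matrix of signature (2,1) on `ℂ³`. -/
noncomputable def hMat : Matrix (Fin 3) (Fin 3) ℂ :=
  !![0, 0, Complex.I; 0, 1, 0; -Complex.I, 0, 0]

/-- The pseudo-Hermitian product `⟨z, w⟩ = ᵗz̄ h w`, conjugate linear in the first slot. -/
noncomputable def herm (z w : Fin 3 → ℂ) : ℂ := star z ⬝ᵥ (hMat *ᵥ w)

/-- The complex projective plane. -/
abbrev CP2 : Type := ℙ ℂ (Fin 3 → ℂ)

/-- The CR 3-sphere: the real hypersurface of isotropic lines. -/
def crSphere : Set CP2 := {P | ∀ v ∈ P.submodule, herm v v = 0}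

/-- The contact form `- i ⟨z, dz⟩ / |z|²` at the isotropic line `[z]`, evaluated at the
tangent vector represented by `v`. -/
noncomputable def contactForm (z v : Fin 3 → ℂ) : ℝ :=
  (-Complex.I * herm z v).re / ∑ i, ‖z i‖ ^ 2

/-! ### Curves -/

/-- `Γ` is a smooth lift to `ℂ³ ∖ {0}` of the curve `γ` of the projective plane. A curve
defined on the line is smooth exactly when it has such a lift. -/
def IsLift (Γ : ℝ → Fin 3 → ℂ) (γ : ℝ → CP2) : Prop :=
  ContDiff ℝ ∞ Γ ∧ ∀ t, ∃ h : Γ t ≠ 0, γ t = Projectivization.mk ℂ (Γ t) h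

/-- The determinant of the matrix with columns `Γ`, `Γ'`, `Γ''` at `t`. -/
noncomputable def wronskian (Γ : ℝ → Fin 3 → ℂ) (t : ℝ) : ℂ :=
  (Matrix.of ![Γ t, deriv Γ t, deriv (deriv Γ) t])ᵀ.det

/-- A smooth curve of the CR sphere which is transversal to the contact distribution, positively
parametrized, and has no CR inflection points. The last two conditions do not depend on the
lift. -/
def IsGenericTransversal (γ : ℝ → CP2) : Prop :=
  (∀ t, γ t ∈ crSphere) ∧
  ∃ Γ, IsLift Γ γ ∧ (∀ t, 0 < contactForm (Γ t) (deriv Γ t)) ∧ ∀ t, wronskian Γ t ≠ 0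

/-- Wilczynski lifts (unique up to a cube root of unity). -/
def IsWLift (Γ : ℝ → Fin 3 → ℂ) (γ : ℝ → CP2) : Prop :=
  IsLift Γ γ ∧ ∀ t, wronskian Γ t = -1

/-- The strain density `i ⟨Γ, Γ'⟩⁻¹` computed with the Wilczynski lift `Γ`. -/
noncomputable def strainDensity (Γ : ℝ → Fin 3 → ℂ) (t : ℝ) : ℂ :=
  Complex.I * (herm (Γ t) (deriv Γ t))⁻¹

/-- The bending `½ ⟨Γ', Γ'⟩` computed with the Wilczynski lift `Γ` of a natural
parametrization; the number `⟨Γ', Γ'⟩` is real. -/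
noncomputable def bending (Γ : ℝ → Fin 3 → ℂ) (t : ℝ) : ℝ :=
  (herm (deriv Γ t) (deriv Γ t)).re / 2

/-- The twist `Im ⟨Γ'', Γ'⟩ + 3 κ²` computed with the Wilczynski lift `Γ` of a natural
parametrization. -/
noncomputable def twist (Γ : ℝ → Fin 3 → ℂ) (t : ℝ) : ℝ :=
  (herm (deriv (deriv Γ) t) (deriv Γ t)).im + 3 * bending Γ t ^ 2

/-- `γ` is the natural parametrization (strain density identically 1) of an isoparametric curve
with constant bending `κ` and constant twist `τ`. -/
def IsIsoparametric (γ : ℝ → CP2) (κ τ : ℝ) : Prop :=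
  IsGenericTransversal γ ∧
  ∃ Γ, IsWLift Γ γ ∧ (∀ t, strainDensity Γ t = 1) ∧ (∀ t, bending Γ t = κ) ∧
    ∀ t, twist Γ t = τ

/-- `γ` is periodic with minimal period `T` and one-to-one on `[0, T)`; the injectivity forces
the period `T` to be minimal. -/
def IsSimpleClosed (γ : ℝ → CP2) : Prop :=
  ∃ T > 0, Function.Periodic γ T ∧ Set.InjOn γ (Set.Ico 0 T)

/-- Isoparametric knots with bending `κ` and twist `τ`. -/
def IsIsoparametricKnot (γ : ℝ → CP2) (κ τ : ℝ) : Prop :=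
  IsIsoparametric γ κ τ ∧ IsSimpleClosed γ

/-! ### The Hamiltonian, the spectral ratio and the two classes -/

/-- The matrix `K` of the Maurer-Cartan pull-back of the Wilczynski frame. -/
noncomputable def kMat (κ τ : ℝ) : Matrix (Fin 3) (Fin 3) ℂ :=
  !![Complex.I * κ, -Complex.I, τ;
     0, -2 * Complex.I * κ, 1;
     1, 0, Complex.I * κ]

/-- The Hamiltonian `H = i K`. -/
noncomputable def hamiltonian (κ τ : ℝ) : Matrix (Fin 3) (Fin 3) ℂ := Complex.I • kMat κ τ

/-- The Hamiltonian has three distinct real eigenvalues `e₁ < e₂ < e₃`, and `r = e₁ / e₃`. -/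
def HasSpectralRatio (κ τ r : ℝ) : Prop :=
  ∃ e₁ e₂ e₃ : ℝ, e₁ < e₂ ∧ e₂ < e₃ ∧
    (hamiltonian κ τ).charpoly.roots = {(e₁ : ℂ), (e₂ : ℂ), (e₃ : ℂ)} ∧ r = e₁ / e₃

/-- The discriminant of the characteristic polynomial of the Hamiltonian. -/
def discrD (κ τ : ℝ) : ℝ :=
  -27 + 108 * κ * (κ ^ 2 + τ) - 324 * κ ^ 4 * τ - 72 * κ ^ 2 * τ ^ 2 - 4 * τ ^ 3

/-- The region of the pairs (bending, twist) of the second class. -/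
def regionMinus : Set (ℝ × ℝ) := {x | 0 < discrD x.1 x.2 ∧ 3 * x.1 < √|x.2|}

/-! ### Heisenberg cyclides -/

/-- The matrix `R(θ₁, θ₂)` of the maximal torus with Clifford angles `θ₁`, `θ₂`. -/
noncomputable def torusMat (θ₁ θ₂ : ℝ) : Matrix (Fin 3) (Fin 3) ℂ :=
  let a : ℂ := Complex.exp (-(Complex.I / 6) * (θ₁ + 2 * θ₂))
  let b : ℂ := Complex.exp (Complex.I / 3 * (θ₁ + 2 * θ₂))
  !![a * Real.cos (θ₁ / 2), 0, a * Real.sin (θ₁ / 2);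
     0, b, 0;
     -(a * Real.sin (θ₁ / 2)), 0, a * Real.cos (θ₁ / 2)]

theorem torusMat_det_ne_zero (θ₁ θ₂ : ℝ) : (torusMat θ₁ θ₂).det ≠ 0 := by
  have h : ((Real.cos (θ₁ / 2) : ℝ) : ℂ) ^ 2 + ((Real.sin (θ₁ / 2) : ℝ) : ℂ) ^ 2 = 1 := by
    exact_mod_cast Real.cos_sq_add_sin_sq (θ₁ / 2)
  have key : (torusMat θ₁ θ₂).det =
      Complex.exp (-(Complex.I / 6) * (θ₁ + 2 * θ₂)) ^ 2 *
        Complex.exp (Complex.I / 3 * (θ₁ + 2 * θ₂)) := by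
    simp only [torusMat, Matrix.det_fin_three, Matrix.of_apply, Matrix.cons_val', Matrix.cons_val]
    linear_combination (Complex.exp (-(Complex.I / 6) * (θ₁ + 2 * θ₂)) ^ 2 *
        Complex.exp (Complex.I / 3 * (θ₁ + 2 * θ₂))) * h
  rw [key]
  exact mul_ne_zero (pow_ne_zero _ (Complex.exp_ne_zero _)) (Complex.exp_ne_zero _)

/-- The projective transformation `R(θ₁, θ₂)`. -/
noncomputable def torusElt (θ₁ θ₂ : ℝ) : GL (Fin 3) ℂ :=
  Matrix.GeneralLinearGroup.mkOfDetNeZero (torusMat θ₁ θ₂) (torusMat_det_ne_zero θ₁ θ₂)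

/-- The action `A [z] = [A z]` of invertible matrices on the projective plane. -/
noncomputable def projAct (A : GL (Fin 3) ℂ) (P : CP2) : CP2 :=
  P.map (Matrix.toLin' (A : Matrix (Fin 3) (Fin 3) ℂ))
    (Matrix.mulVec_injective_iff_isUnit.2 A.isUnit)

theorem basePoint_ne_zero (ρ : ℝ) :
    (![1, (ρ : ℂ), Complex.I / 2 * (ρ : ℂ) ^ 2] : Fin 3 → ℂ) ≠ 0 := by
  intro h
  simpa using congrFun h 0

/-- The point `[1, ρ, i ρ² / 2]` of the CR sphere. -/
noncomputable def basePoint (ρ : ℝ) : CP2 :=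
  Projectivization.mk ℂ ![1, (ρ : ℂ), Complex.I / 2 * (ρ : ℂ) ^ 2] (basePoint_ne_zero ρ)

/-- The standard Heisenberg cyclide: the orbit of the maximal torus through `basePoint ρ`. -/
def cyclide (ρ : ℝ) : Set CP2 :=
  {P | ∃ θ₁ θ₂ : ℝ, P = projAct (torusElt θ₁ θ₂) (basePoint ρ)}

/-- The closed curve on the cyclide which, in the Clifford angles, winds `p` times in the direction
of `θ₂` (around the axis `cyclide 0`) and `-q` times in the direction of `θ₁` (around
the axis `cyclide √2`). -/
def cyclideCurve (ρ : ℝ) (p q : ℤ) : Set CP2 :=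
  {P | ∃ φ : ℝ, P = projAct (torusElt (-(q * φ)) (p * φ)) (basePoint ρ)}

/-! ### Torus knots -/

/-- The unit sphere of `ℂ²`. -/
abbrev S3 : Type := Metric.sphere (0 : EuclideanSpace ℂ (Fin 2)) 1

instance finrankFact : Fact (Module.finrank ℝ (EuclideanSpace ℂ (Fin 2)) = 3 + 1) :=
  ⟨by
    have h := Module.finrank_mul_finrank ℝ ℂ (EuclideanSpace ℂ (Fin 2))
    rw [Complex.finrank_real_complex, finrank_euclideanSpace_fin] at h
    omega⟩

theorem sphereVec_ne_zero (z : S3) :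
    (![(1 + z.1 0) / 2, Complex.I * z.1 1 / (√2 : ℝ), Complex.I * ((1 - z.1 0) / 2)] :
      Fin 3 → ℂ) ≠ 0 := by
  intro h
  have h0 : (1 + z.1 0) / 2 = 0 := by simpa using congrFun h 0
  have h2 : (1 - z.1 0) / 2 = 0 := by simpa using congrFun h 2
  have : (1 : ℂ) = 0 := by linear_combination h0 + h2
  exact one_ne_zero this

/-- The diffeomorphism of the unit sphere of `ℂ²` onto the CR sphere,
`(z₁, z₂) ↦ [(1 + z₁) / 2, i z₂ / √2, i (1 - z₁) / 2]`. -/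
noncomputable def sphereMap (z : S3) : CP2 :=
  Projectivization.mk ℂ _ (sphereVec_ne_zero z)

/-- Smooth ambient isotopy of subsets of the 3-sphere: a smooth family of diffeomorphisms that
starts at the identity and ends at a diffeomorphism carrying `K` onto `L`. -/
def AmbientIsotopic (K L : Set S3) : Prop :=
  ∃ Φ : ℝ → S3 ≃ₘ⟮𝓡 3, 𝓡 3⟯ S3,
    ContMDiff (𝓘(ℝ, ℝ).prod (𝓡 3)) (𝓡 3) ∞ (fun x : ℝ × S3 => Φ x.1 x.2) ∧
    (∀ x, Φ 0 x = x) ∧ Φ 1 '' K = L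

/-- The standard positive torus knot of type `(p, q)` in the unit sphere of `ℂ²`, parametrized by
`t ↦ (exp (i q t), exp (i p t)) / √2`. -/
def stdTorusKnot (p q : ℤ) : Set S3 :=
  {z | ∃ t : ℝ, z.1 0 = Complex.exp (Complex.I * (q * t)) / (√2 : ℝ) ∧
    z.1 1 = Complex.exp (Complex.I * (p * t)) / (√2 : ℝ)}

/-- A subset `K` of the CR sphere is a positive torus knot of type `(p, q)`, where `p` and `q` are
coprime positive integers. The orientation is that of the unit sphere of `ℂ²`, which
is also that of the contact structure. -/
def IsPositiveTorusKnot (p q : ℤ) (K : Set CP2) : Prop :=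
  0 < p ∧ 0 < q ∧ IsCoprime p q ∧ K ⊆ crSphere ∧
    AmbientIsotopic (sphereMap ⁻¹' K) (stdTorusKnot p q)

/-! ### Symmetrical configurations of the second kind -/

/-- The function `μ₂`, with values in `(0, 1)` for `-2 < r < -1/2` and `0 < ρ < √2`. -/
noncomputable def mu2 (r ρ : ℝ) : ℝ :=
  (-4 + 4 * r - 12 * ρ ^ 2 * (1 + r) + (r - 1) * ρ ^ 4) /
    (-4 + 4 * r - 12 * ρ ^ 2 * (1 + r) + (r - 1) * ρ ^ 4
      - 2 * ((2 + 3 * r - 3 * r ^ 2 - 2 * r ^ 3) * (-4 * ρ + ρ ^ 5)) ^ (2 / 3 : ℝ))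

/-- The matrix `diag(-i e³, -i e², -i e¹)`, where `e¹ = r m`, `e² = -(1 + r) m`, `e³ = m` and
`m = μ₂ / (1 - μ₂)`. -/
noncomputable def dMat (r ρ : ℝ) : Matrix (Fin 3) (Fin 3) ℂ :=
  let m : ℝ := mu2 r ρ / (1 - mu2 r ρ)
  Matrix.diagonal ![-Complex.I * m, -Complex.I * (-(1 + r) * m : ℝ), -Complex.I * (r * m : ℝ)]

/-- The matrix of a pseudo-unitary basis. -/
noncomputable def uMat : Matrix (Fin 3) (Fin 3) ℂ :=
  !![1 / (√2 : ℝ), 0, Complex.I / (√2 : ℝ);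
     0, 1, 0;
     Complex.I / (√2 : ℝ), 0, 1 / (√2 : ℝ)]

theorem uMat_det_ne_zero : uMat.det ≠ 0 := by
  have h : ((√2 : ℝ) : ℂ) ^ 2 = 2 := by
    exact_mod_cast Real.sq_sqrt (show (0 : ℝ) ≤ 2 by norm_num)
  have h0 : ((√2 : ℝ) : ℂ) ≠ 0 := by
    intro h0
    rw [h0] at h
    norm_num at h
  have key : uMat.det = 1 := by
    simp only [uMat, Matrix.det_fin_three, Matrix.of_apply, Matrix.cons_val', Matrix.cons_val]
    field_simp
    rw [h, Complex.I_sq]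
    norm_num
  rw [key]
  exact one_ne_zero

/-- The invertible matrix `U`. -/
noncomputable def uElt : GL (Fin 3) ℂ :=
  Matrix.GeneralLinearGroup.mkOfDetNeZero uMat uMat_det_ne_zero

/-- The matrix exponential as an invertible matrix. -/
noncomputable def expElt (A : Matrix (Fin 3) (Fin 3) ℂ) : GL (Fin 3) ℂ :=
  (Matrix.isUnit_exp A).unit

/-- The symmetrical configuration of the second kind `s ↦ U exp(s D) U⁻¹ [1, ρ, i ρ² / 2]`. -/
noncomputable def symmConf2 (r ρ : ℝ) (s : ℝ) : CP2 :=
  projAct (uElt * expElt (s • dMat r ρ) * uElt⁻¹) (basePoint ρ)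

end CRKnot

/-!
The matrix `U` diagonalizes at once the Hermitian form, which becomes `diag(-1, 1, 1)`, the
one-parameter group that generates the configuration, and the maximal torus `R(θ₁, θ₂)`. Everything
is computed in the coordinates `w` of this frame.

For the local invariants, a multiple of the orbit `exp(s D) w`, `D = diag(-i e₀, -i e₁, -i e₂)`, is
taken as the lift. All products of its derivatives are moments of the weights `-|w₀|², |w₁|², |w₂|²`
with respect to the spectrum, and its Wronskian is a Vandermonde determinant; the value of `m` is
exactly the one for which one constant normalizes both the Wronskian and the strain density
(`exists_scale`, `isoparametric_symmConf2`). The elementary symmetric functions of the spectrum are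
recovered from the moments (`symmetric_functions`), which identifies the characteristic polynomial
of the Hamiltonian with `∏ (X - eⱼ)` and the discriminant `D` with the square of the Vandermonde
determinant. The curve is of the second class because its timelike direction belongs to the largest
eigenvalue: the positive weight of the middle eigenvalue gives `2κ < e₂`, hence a negative
derivative of the characteristic polynomial at `2κ` if `κ ≥ 0`, and this is `τ < -9κ²`
(`mem_regionMinus`).

For the global part, the affine coordinates `w₁ / w₀`, `w₂ / w₀` are, up to a unit factor and a
transposition, those of the unit sphere of `ℂ²` (`sphereMap_eq`). In them the torus acts by
rotations and the configuration is
`s ↦ (x exp(i (2 + r) m s), y exp(i (1 - r) m s))`. Writing `(2 + r) m = p k`, `(1 - r) m = q k`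
with coprime `p`, `q` exhibits it as a simple closed curve of the torus orbit
(`symmConf2_eq_torus`, `isSimpleClosed_of_torus`). The radial projection of a diagonal linear flow
of `ℂ²` is a smooth flow of the sphere that carries this curve to the standard torus knot
(`ambientIsotopic_stdTorusKnot`).
-/

namespace CRKnot

/-! ### The pseudo-unitary frame -/

theorem sqrt_two_sq : ((√2 : ℝ) : ℂ) ^ 2 = 2 := by
  exact_mod_cast Real.sq_sqrt (show (0 : ℝ) ≤ 2 by norm_num)

theorem sqrt_two_ne_zero : ((√2 : ℝ) : ℂ) ≠ 0 := by
  simp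

theorem uMat_mulVec (a : Fin 3 → ℂ) :
    uMat *ᵥ a = ![(a 0 + Complex.I * a 2) / (√2 : ℝ), a 1,
      (Complex.I * a 0 + a 2) / (√2 : ℝ)] := by
  ext i
  fin_cases i <;> simp [uMat, Matrix.mulVec, dotProduct, Fin.sum_univ_three] <;> ring

theorem uMat_det : uMat.det = 1 := by
  have h0 := sqrt_two_ne_zero
  simp only [uMat, Matrix.det_fin_three, Matrix.of_apply, Matrix.cons_val', Matrix.cons_val]
  field_simp
  rw [sqrt_two_sq, Complex.I_sq]
  norm_num

theorem uMat_mulVec_injective : Function.Injective (uMat *ᵥ ·) :=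
  Matrix.mulVec_injective_iff_isUnit.2 uElt.isUnit

theorem uMat_mulVec_ne_zero {a : Fin 3 → ℂ} (ha : a ≠ 0) : uMat *ᵥ a ≠ 0 := fun h =>
  ha (uMat_mulVec_injective (by simpa using h))

theorem herm_eq (z w : Fin 3 → ℂ) :
    herm z w = star (z 0) * (Complex.I * w 2) + star (z 1) * w 1
      - star (z 2) * (Complex.I * w 0) := by
  simp [herm, hMat, Matrix.mulVec, dotProduct, Fin.sum_univ_three]
  ring

/-- The columns of `U` form a pseudo-unitary basis, whose first vector is timelike. -/
theorem herm_uMat (a b : Fin 3 → ℂ) :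
    herm (uMat *ᵥ a) (uMat *ᵥ b) =
      -(star (a 0) * b 0) + star (a 1) * b 1 + star (a 2) * b 2 := by
  have h0 := sqrt_two_ne_zero
  simp only [herm_eq, uMat_mulVec, Matrix.cons_val]
  simp
  field_simp
  rw [sqrt_two_sq]
  ring_nf
  simp only [Complex.I_sq, show Complex.I ^ 3 = -Complex.I by rw [pow_succ, Complex.I_sq]; ring]
  ring

theorem det_uMat_mulVec (a b c : Fin 3 → ℂ) :
    (Matrix.of ![uMat *ᵥ a, uMat *ᵥ b, uMat *ᵥ c])ᵀ.det = (Matrix.of ![a, b, c])ᵀ.det := by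
  have : (Matrix.of ![uMat *ᵥ a, uMat *ᵥ b, uMat *ᵥ c])ᵀ =
      uMat * (Matrix.of ![a, b, c])ᵀ := by
    ext i j
    fin_cases j <;> rfl
  rw [this, Matrix.det_mul, uMat_det, one_mul]

/-! ### Orbits of one-parameter diagonal groups -/

/-- The orbit `s ↦ U exp(s D) w` in `ℂ³`, where `D = diag(-i e₀, -i e₁, -i e₂)` and `w` is the
vector of coordinates, in the basis formed by the columns of `U`, of the initial point. -/
noncomputable def diagCurve (e : Fin 3 → ℝ) (w : Fin 3 → ℂ) (s : ℝ) : Fin 3 → ℂ :=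
  uMat *ᵥ fun j => Complex.exp (-Complex.I * e j * s) * w j

theorem hasDerivAt_diagCurve (e : Fin 3 → ℝ) (w : Fin 3 → ℂ) (s : ℝ) :
    HasDerivAt (diagCurve e w) (diagCurve e (fun j => -Complex.I * e j * w j) s) s := by
  have h : HasDerivAt (fun (s : ℝ) (j : Fin 3) => Complex.exp (-Complex.I * e j * s) * w j)
      (fun j => Complex.exp (-Complex.I * e j * s) * (-Complex.I * e j * w j)) s := by
    refine hasDerivAt_pi.2 fun j => ?_
    have h1 : HasDerivAt (fun x : ℝ => -Complex.I * e j * (x : ℂ)) (-Complex.I * e j) s := by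
      simpa using (Complex.ofRealCLM.hasDerivAt (x := s)).const_mul (-Complex.I * e j)
    exact (h1.cexp.mul_const (w j)).congr_deriv (by ring)
  exact ((Matrix.mulVecLin uMat).toContinuousLinearMap.restrictScalars
    ℝ).hasFDerivAt.comp_hasDerivAt s h

theorem deriv_diagCurve (e : Fin 3 → ℝ) (w : Fin 3 → ℂ) :
    deriv (diagCurve e w) = diagCurve e (fun j => -Complex.I * e j * w j) :=
  funext fun s => (hasDerivAt_diagCurve e w s).deriv

theorem contDiff_diagCurve (e : Fin 3 → ℝ) (w : Fin 3 → ℂ) : ContDiff ℝ ∞ (diagCurve e w) := by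
  have hU : ContDiff ℝ ∞ (uMat *ᵥ ·) :=
    ((Matrix.mulVecLin uMat).toContinuousLinearMap.restrictScalars ℝ).contDiff
  refine hU.comp ?_
  refine contDiff_pi.2 fun j => ContDiff.mul (ContDiff.cexp ?_) contDiff_const
  exact contDiff_const.mul Complex.ofRealCLM.contDiff

theorem star_exp_mul_exp (x : ℝ) (a b : ℂ) (s : ℝ) :
    star (Complex.exp (-Complex.I * x * s) * a) * (Complex.exp (-Complex.I * x * s) * b) =
      star a * b := by
  have h : star (Complex.exp (-Complex.I * x * s)) * Complex.exp (-Complex.I * x * s) = 1 := by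
    rw [Complex.star_def, ← Complex.exp_conj, ← Complex.exp_add]
    simp
  rw [star_mul]
  linear_combination (star a * b) * h

/-- The one-parameter group is pseudo-unitary. -/
theorem herm_diagCurve (e : Fin 3 → ℝ) (a b : Fin 3 → ℂ) (s : ℝ) :
    herm (diagCurve e a s) (diagCurve e b s) =
      -(star (a 0) * b 0) + star (a 1) * b 1 + star (a 2) * b 2 := by
  simp only [diagCurve, herm_uMat, star_exp_mul_exp]

/-- For a trace-free `D` the Wronskian of an orbit is constant; it is a Vandermonde determinant
times the product of the coordinates of the initial point. -/
theorem wronskian_diagCurve {e : Fin 3 → ℝ} (he : e 0 + e 1 + e 2 = 0) (w : Fin 3 → ℂ) (s : ℝ) :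
    wronskian (diagCurve e w) s =
      Complex.I * (w 0 * w 1 * w 2) * ((e 1 - e 0) * (e 2 - e 0) * (e 2 - e 1)) := by
  have h : Complex.exp (-Complex.I * e 0 * s) * Complex.exp (-Complex.I * e 1 * s) *
      Complex.exp (-Complex.I * e 2 * s) = 1 := by
    rw [← Complex.exp_add, ← Complex.exp_add, Complex.exp_eq_one_iff]
    refine ⟨0, ?_⟩
    have : (e 0 : ℂ) + e 1 + e 2 = 0 := by exact_mod_cast he
    linear_combination (-Complex.I * s) * this
  have hI : Complex.I ^ 3 = -Complex.I := by rw [pow_succ, Complex.I_sq]; ring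
  rw [wronskian, deriv_diagCurve, deriv_diagCurve]
  simp only [diagCurve]
  rw [det_uMat_mulVec]
  simp only [Matrix.det_fin_three, Matrix.transpose_apply,
    Matrix.of_apply, Matrix.cons_val', Matrix.cons_val]
  linear_combination (Complex.I * (w 0 * w 1 * w 2) * ((e 1 - e 0) * (e 2 - e 0) * (e 2 - e 1)))
    * h - (Complex.exp (-Complex.I * e 0 * s) * Complex.exp (-Complex.I * e 1 * s) *
      Complex.exp (-Complex.I * e 2 * s) * (w 0 * w 1 * w 2) *
      ((e 1 - e 0) * (e 2 - e 0) * (e 2 - e 1))) * hI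

theorem mk_mem_crSphere {v : Fin 3 → ℂ} (hv : v ≠ 0) :
    Projectivization.mk ℂ v hv ∈ crSphere ↔ herm v v = 0 := by
  simp only [crSphere, Set.mem_ofPred_eq, Projectivization.submodule_mk,
    Submodule.mem_span_singleton]
  constructor
  · exact fun h => h v ⟨1, one_smul _ _⟩
  · rintro h _ ⟨a, rfl⟩
    rw [herm_eq] at h
    simp only [herm_eq, Pi.smul_apply, smul_eq_mul, star_mul]
    linear_combination (a * star a) * h

/-- The moment `-e₀ⁿ |w₀|² + e₁ⁿ |w₁|² + e₂ⁿ |w₂|²`, which is `⟨w, Hⁿ w⟩` for the Hermitian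
operator `H = i U D U⁻¹` with eigenvalues `e₀, e₁, e₂`. -/
noncomputable def moment (e : Fin 3 → ℝ) (w : Fin 3 → ℂ) (n : ℕ) : ℝ :=
  -(e 0 ^ n * Complex.normSq (w 0)) + e 1 ^ n * Complex.normSq (w 1)
    + e 2 ^ n * Complex.normSq (w 2)

/-- An orbit normalized by its moments and its Wronskian is a natural parametrization of an
isoparametric curve, with the second moment as twice its bending. -/
theorem isIsoparametric_of_moment {e : Fin 3 → ℝ} {w : Fin 3 → ℂ} {γ : ℝ → CP2}
    (he : e 0 + e 1 + e 2 = 0) (hγ : ∀ s, ∃ h : diagCurve e w s ≠ 0,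
      γ s = Projectivization.mk ℂ (diagCurve e w s) h)
    (h0 : moment e w 0 = 0) (h1 : moment e w 1 = -1)
    (hW : Complex.I * (w 0 * w 1 * w 2) * ((e 1 - e 0) * (e 2 - e 0) * (e 2 - e 1)) = -1) :
    IsIsoparametric γ (moment e w 2 / 2) (moment e w 3 + 3 * (moment e w 2 / 2) ^ 2) := by
  have hlift : IsLift (diagCurve e w) γ := ⟨contDiff_diagCurve e w, hγ⟩
  have hwr : ∀ s, wronskian (diagCurve e w) s = -1 := fun s => by
    rw [wronskian_diagCurve he, hW]
  have hn : ∀ z : ℂ, star z * z = Complex.normSq z := fun z => by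
    rw [Complex.normSq_eq_conj_mul_self]; rfl
  have k0 : ∀ s, herm (diagCurve e w s) (diagCurve e w s) = 0 := fun s => by
    rw [herm_diagCurve, hn, hn, hn]
    have : ((moment e w 0 : ℝ) : ℂ) = 0 := by simp [h0]
    simpa [moment] using this
  have k1 : ∀ s, herm (diagCurve e w s) (deriv (diagCurve e w) s) = Complex.I := fun s => by
    rw [deriv_diagCurve, herm_diagCurve]
    have : ((moment e w 1 : ℝ) : ℂ) = -1 := by simp [h1]
    simp only [moment, Complex.ofReal_add, Complex.ofReal_neg, Complex.ofReal_mul,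
      Complex.ofReal_pow, ← hn] at this
    linear_combination (-Complex.I) * this
  have k2 : ∀ s, herm (deriv (diagCurve e w) s) (deriv (diagCurve e w) s) = moment e w 2 :=
    fun s => by
    rw [deriv_diagCurve, herm_diagCurve]
    simp only [moment, Complex.ofReal_add, Complex.ofReal_neg, Complex.ofReal_mul,
      Complex.ofReal_pow, ← hn, star_mul, star_neg, Complex.star_def, Complex.conj_I,
      Complex.conj_ofReal]
    ring_nf
    simp only [Complex.I_sq]
    ring
  have k3 : ∀ s, herm (deriv (deriv (diagCurve e w)) s) (deriv (diagCurve e w) s) =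
      Complex.I * moment e w 3 := fun s => by
    rw [deriv_diagCurve, deriv_diagCurve, herm_diagCurve]
    simp only [moment, Complex.ofReal_add, Complex.ofReal_neg, Complex.ofReal_mul,
      Complex.ofReal_pow, ← hn, star_mul, star_neg, Complex.star_def, Complex.conj_I,
      Complex.conj_ofReal]
    ring_nf
    simp only [show Complex.I ^ 3 = -Complex.I by rw [pow_succ, Complex.I_sq]; ring]
    ring
  have kb : ∀ s, bending (diagCurve e w) s = moment e w 2 / 2 := fun s => by
    rw [bending, k2, Complex.ofReal_re]
  refine ⟨⟨fun s => ?_, diagCurve e w, hlift, fun s => ?_, fun s => ?_⟩,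
    diagCurve e w, ⟨hlift, hwr⟩, fun s => ?_, kb, fun s => ?_⟩
  · obtain ⟨h, hs⟩ := hγ s
    rw [hs, mk_mem_crSphere, k0]
  · rw [contactForm, k1, neg_mul, Complex.I_mul_I, neg_neg, Complex.one_re]
    obtain ⟨h, -⟩ := hγ s
    refine one_div_pos.2 ?_
    obtain ⟨i, hi⟩ := Function.ne_iff.1 h
    exact Finset.sum_pos' (fun i _ => by positivity)
      ⟨i, Finset.mem_univ _, by have := norm_pos_iff.2 hi; positivity⟩
  · rw [hwr]; norm_num
  · rw [strainDensity, k1, mul_inv_cancel₀ Complex.I_ne_zero]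
  · rw [twist, kb, k3]
    simp

/-! ### Affine coordinates on the complement of a line -/

/-- The point with affine coordinates `x`, `y` in the frame `U`. The CR sphere is the unit sphere
`|x|² + |y|² = 1` in these coordinates. -/
noncomputable def diagPoint (x y : ℂ) : CP2 :=
  Projectivization.mk ℂ (uMat *ᵥ ![1, x, y])
    (uMat_mulVec_ne_zero fun h => one_ne_zero (congrFun h 0))

theorem mk_uMat {v a : Fin 3 → ℂ} (hv : v ≠ 0) (h : v = uMat *ᵥ a) (ha : a 0 ≠ 0) :
    Projectivization.mk ℂ v hv = diagPoint (a 1 / a 0) (a 2 / a 0) := by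
  subst h
  rw [diagPoint, Projectivization.mk_eq_mk_iff']
  refine ⟨a 0, ?_⟩
  rw [← Matrix.mulVec_smul]
  congr 1
  ext i
  fin_cases i <;> simp [mul_div_cancel₀, ha]

theorem diagPoint_inj {x y x' y' : ℂ} :
    diagPoint x y = diagPoint x' y' ↔ x = x' ∧ y = y' := by
  refine ⟨fun h => ?_, by rintro ⟨rfl, rfl⟩; rfl⟩
  rw [diagPoint, diagPoint, Projectivization.mk_eq_mk_iff'] at h
  obtain ⟨a, ha⟩ := h
  rw [← Matrix.mulVec_smul] at ha
  have h := uMat_mulVec_injective ha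
  have h0 : a = 1 := by simpa using congrFun h 0
  subst h0
  exact ⟨by simpa using (congrFun h 1).symm, by simpa using (congrFun h 2).symm⟩

theorem diagPoint_mem_crSphere {x y : ℂ} :
    diagPoint x y ∈ crSphere ↔ ‖x‖ ^ 2 + ‖y‖ ^ 2 = 1 := by
  have hn : ∀ z : ℂ, star z * z = ((‖z‖ ^ 2 : ℝ) : ℂ) := fun z => by
    rw [← Complex.normSq_eq_norm_sq, Complex.normSq_eq_conj_mul_self]; rfl
  rw [diagPoint, mk_mem_crSphere, herm_uMat]
  simp only [Matrix.cons_val, hn, norm_one]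
  rw [← Complex.ofReal_inj]
  push_cast
  constructor <;> intro h <;> linear_combination h

theorem sphereMap_eq (z : S3) :
    sphereMap z = diagPoint (Complex.I * z.1 1) (-Complex.I * z.1 0) := by
  have h0 := sqrt_two_ne_zero
  have h := mk_uMat (a := ![1 / (√2 : ℝ), Complex.I * z.1 1 / (√2 : ℝ),
    -Complex.I * z.1 0 / (√2 : ℝ)]) (sphereVec_ne_zero z) ?_ (by simp)
  · rw [sphereMap, h]
    simp only [Matrix.cons_val]
    congr 1 <;> field_simp
  · rw [uMat_mulVec]
    ext i
    fin_cases i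
    · simp
      field_simp
      rw [sqrt_two_sq]
      linear_combination 2 * z.1 0 * Complex.I_sq
    · simp
    · simp
      field_simp
      rw [sqrt_two_sq]
      ring

/-! ### Spectrum of the Hamiltonian and the second class -/

section Spectrum

variable {e₁ e₂ e₃ p₁ p₂ p₃ κ τ : ℝ}

/-- The weights `pⱼ` are determined by the eigenvalues and the first three moments. -/
theorem weight_eq (he : e₁ + e₂ + e₃ = 0) (h0 : p₁ + p₂ + p₃ = 0)
    (h1 : e₁ * p₁ + e₂ * p₂ + e₃ * p₃ = -1)
    (h2 : e₁ ^ 2 * p₁ + e₂ ^ 2 * p₂ + e₃ ^ 2 * p₃ = 2 * κ) :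
    p₁ * ((e₁ - e₂) * (e₁ - e₃)) = 2 * κ - e₁ := by
  linear_combination h2 - (e₂ + e₃) * h1 + e₂ * e₃ * h0 + he

theorem hamiltonian_charpoly (he : e₁ + e₂ + e₃ = 0)
    (hσ₂ : e₁ * e₂ + e₁ * e₃ + e₂ * e₃ = τ - 3 * κ ^ 2)
    (hσ₃ : e₁ * e₂ * e₃ = 2 * κ ^ 3 + 2 * κ * τ - 1) :
    (hamiltonian κ τ).charpoly =
      (Multiset.map (fun a => Polynomial.X - Polynomial.C a) {(e₁ : ℂ), (e₂ : ℂ), (e₃ : ℂ)}).prod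
    := by
  have he' : (e₁ : ℂ) + e₂ + e₃ = 0 := by exact_mod_cast he
  have hσ₂' : (e₁ : ℂ) * e₂ + e₁ * e₃ + e₂ * e₃ = τ - 3 * κ ^ 2 := by exact_mod_cast hσ₂
  have hσ₃' : (e₁ : ℂ) * e₂ * e₃ = 2 * κ ^ 3 + 2 * κ * τ - 1 := by exact_mod_cast hσ₃
  refine Polynomial.funext fun x => ?_
  rw [Matrix.eval_charpoly]
  simp only [hamiltonian, kMat, Matrix.det_fin_three, Matrix.scalar_apply, Matrix.sub_apply,
    Matrix.smul_apply, Matrix.of_apply, Matrix.cons_val', Matrix.cons_val, smul_eq_mul]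
  simp [-mul_eq_mul_left_iff, -mul_eq_mul_right_iff]
  have hI := Complex.I_sq
  have hI4 : Complex.I ^ 4 = 1 := Complex.I_pow_four
  have hI6 : Complex.I ^ 6 = -1 := by rw [pow_add _ 4 2, hI, hI4]; norm_num
  ring_nf
  simp only [hI, hI4, hI6]
  linear_combination x ^ 2 * he' - x * hσ₂' + hσ₃'

theorem discrD_eq (he : e₁ + e₂ + e₃ = 0)
    (hσ₂ : e₁ * e₂ + e₁ * e₃ + e₂ * e₃ = τ - 3 * κ ^ 2)
    (hσ₃ : e₁ * e₂ * e₃ = 2 * κ ^ 3 + 2 * κ * τ - 1) :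
    discrD κ τ = ((e₂ - e₁) * (e₃ - e₁) * (e₃ - e₂)) ^ 2 := by
  have h : discrD κ τ =
      -4 * (τ - 3 * κ ^ 2) ^ 3 - 27 * (2 * κ ^ 3 + 2 * κ * τ - 1) ^ 2 := by
    rw [discrD]; ring
  rw [h, ← hσ₂, ← hσ₃]
  obtain rfl : e₁ = -e₂ - e₃ := by linear_combination he
  ring

/-- Bending and twist in terms of the spectrum. The hypothesis `hG` on the product of the weights
is the normalization of the Wronskian. Since `pⱼ` times the derivative of the characteristic
polynomial at `eⱼ` is `2κ - eⱼ`, it says that the characteristic polynomial takes the value `1`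
at `2κ`. -/
theorem symmetric_functions (he : e₁ + e₂ + e₃ = 0) (h0 : p₁ + p₂ + p₃ = 0)
    (h1 : e₁ * p₁ + e₂ * p₂ + e₃ * p₃ = -1)
    (h2 : e₁ ^ 2 * p₁ + e₂ ^ 2 * p₂ + e₃ ^ 2 * p₃ = 2 * κ)
    (h3 : e₁ ^ 3 * p₁ + e₂ ^ 3 * p₂ + e₃ ^ 3 * p₃ = τ - 3 * κ ^ 2)
    (hG : p₁ * p₂ * p₃ * ((e₂ - e₁) * (e₃ - e₁) * (e₃ - e₂)) ^ 2 = -1) :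
    e₁ * e₂ + e₁ * e₃ + e₂ * e₃ = τ - 3 * κ ^ 2 ∧
      e₁ * e₂ * e₃ = 2 * κ ^ 3 + 2 * κ * τ - 1 := by
  have hσ₂ : e₁ * e₂ + e₁ * e₃ + e₂ * e₃ = τ - 3 * κ ^ 2 := by
    linear_combination h3 - (e₁ ^ 2 * p₁ + e₂ ^ 2 * p₂ + e₃ ^ 2 * p₃) * he
      + (e₁ * e₂ + e₁ * e₃ + e₂ * e₃) * h1 - e₁ * e₂ * e₃ * h0
  refine ⟨hσ₂, ?_⟩
  have w1 := weight_eq he h0 h1 h2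
  have w2 := weight_eq (e₁ := e₂) (e₂ := e₃) (e₃ := e₁) (p₁ := p₂) (p₂ := p₃) (p₃ := p₁)
    (by linarith) (by linarith) (by linarith) (by linarith : _ = 2 * κ)
  have w3 := weight_eq (e₁ := e₃) (e₂ := e₁) (e₃ := e₂) (p₁ := p₃) (p₂ := p₁) (p₃ := p₂)
    (by linarith) (by linarith) (by linarith) (by linarith : _ = 2 * κ)
  have hprod : (2 * κ - e₁) * (2 * κ - e₂) * (2 * κ - e₃) = 1 := by
    rw [← w1, ← w2, ← w3]
    linear_combination -hG
  linear_combination -hprod - 4 * κ ^ 2 * he + 2 * κ * hσ₂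

/-- If the middle weight is positive then `2κ < e₂`, so for `κ ≥ 0` the characteristic polynomial
decreases at `2κ`, that is, `τ < -9κ²`. -/
theorem mem_regionMinus (he : e₁ + e₂ + e₃ = 0) (h12 : e₁ < e₂) (h23 : e₂ < e₃) (hp : 0 < p₂)
    (h0 : p₁ + p₂ + p₃ = 0) (h1 : e₁ * p₁ + e₂ * p₂ + e₃ * p₃ = -1)
    (h2 : e₁ ^ 2 * p₁ + e₂ ^ 2 * p₂ + e₃ ^ 2 * p₃ = 2 * κ)
    (hσ₂ : e₁ * e₂ + e₁ * e₃ + e₂ * e₃ = τ - 3 * κ ^ 2)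
    (hσ₃ : e₁ * e₂ * e₃ = 2 * κ ^ 3 + 2 * κ * τ - 1) :
    (κ, τ) ∈ regionMinus := by
  refine ⟨?_, ?_⟩
  · rw [discrD_eq he hσ₂ hσ₃]
    exact pow_pos (mul_pos (mul_pos (by linarith) (by linarith)) (by linarith)) 2
  · rcases lt_or_ge κ 0 with hκ | hκ
    · exact (show 3 * κ < 0 by linarith).trans_le (Real.sqrt_nonneg _)
    · have w2 := weight_eq (e₁ := e₂) (e₂ := e₃) (e₃ := e₁) (p₁ := p₂) (p₂ := p₃) (p₃ := p₁)
        (by linarith) (by linarith) (by linarith) (by linarith : _ = 2 * κ)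
      have hneg : (e₂ - e₃) * (e₂ - e₁) < 0 :=
        mul_neg_of_neg_of_pos (by linarith) (by linarith)
      have hκ2 : 2 * κ < e₂ := by nlinarith
      have hsq : (2 * κ) ^ 2 < e₂ ^ 2 := by
        gcongr
      have hf : (e₂ - e₃) * (e₂ - e₁) = 3 * e₂ ^ 2 + (τ - 3 * κ ^ 2) := by
        rw [← hσ₂]
        linear_combination -2 * e₂ * he
      have hτ : τ < -(9 * κ ^ 2) := by linarith
      refine (Real.lt_sqrt (by linarith)).2 ?_
      calc (3 * κ) ^ 2 = 9 * κ ^ 2 := by ring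
        _ < -τ := by linarith
        _ ≤ |τ| := neg_le_abs τ

end Spectrum

/-! ### The diagonal flow of the 3-sphere -/

/-- The linear flow `diag(exp(t a₀), exp(t a₁))` of `ℂ²`. -/
noncomputable def linFlow (a : Fin 2 → ℂ) (t : ℝ) (z : EuclideanSpace ℂ (Fin 2)) :
    EuclideanSpace ℂ (Fin 2) :=
  WithLp.toLp 2 fun j => Complex.exp (t * a j) * z j

theorem linFlow_apply (a : Fin 2 → ℂ) (t : ℝ) (z : EuclideanSpace ℂ (Fin 2)) (j : Fin 2) :
    linFlow a t z j = Complex.exp (t * a j) * z j := rfl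

theorem linFlow_add (a : Fin 2 → ℂ) (s t : ℝ) (z : EuclideanSpace ℂ (Fin 2)) :
    linFlow a s (linFlow a t z) = linFlow a (s + t) z := by
  ext j
  simp only [linFlow_apply, Complex.ofReal_add, add_mul, Complex.exp_add]
  ring

theorem linFlow_zero (a : Fin 2 → ℂ) (z : EuclideanSpace ℂ (Fin 2)) : linFlow a 0 z = z := by
  ext j
  simp [linFlow_apply]

theorem linFlow_smul (a : Fin 2 → ℂ) (t c : ℝ) (z : EuclideanSpace ℂ (Fin 2)) :
    linFlow a t (c • z) = c • linFlow a t z := by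
  ext j
  simp [linFlow_apply]
  ring

theorem linFlow_ne_zero (a : Fin 2 → ℂ) (t : ℝ) {z : EuclideanSpace ℂ (Fin 2)} (hz : z ≠ 0) :
    linFlow a t z ≠ 0 := fun h => hz <| by
  ext j
  have := congrArg (fun v : EuclideanSpace ℂ (Fin 2) => v j) h
  simpa [linFlow_apply] using this

theorem contDiff_linFlow (a : Fin 2 → ℂ) :
    ContDiff ℝ ∞ fun x : ℝ × EuclideanSpace ℂ (Fin 2) => linFlow a x.1 x.2 := by
  refine (contDiff_piLp 2).2 fun j => ContDiff.mul (ContDiff.cexp ?_) ?_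
  · exact (Complex.ofRealCLM.contDiff.comp contDiff_fst).mul contDiff_const
  · exact ((EuclideanSpace.proj (𝕜 := ℂ) j).restrictScalars ℝ).contDiff.comp contDiff_snd

/-- The flow that the linear flow induces on the unit sphere by radial projection. -/
noncomputable def sphereFlow (a : Fin 2 → ℂ) (t : ℝ) (z : S3) : S3 :=
  ⟨‖linFlow a t z.1‖⁻¹ • linFlow a t z.1, by
    have : linFlow a t z.1 ≠ 0 := linFlow_ne_zero a t (ne_zero_of_mem_unit_sphere z)
    simp [norm_smul, this]⟩

theorem sphereFlow_add (a : Fin 2 → ℂ) (s t : ℝ) (z : S3) :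
    sphereFlow a s (sphereFlow a t z) = sphereFlow a (s + t) z := by
  have h : 0 < ‖linFlow a t z.1‖ :=
    norm_pos_iff.2 (linFlow_ne_zero a t (ne_zero_of_mem_unit_sphere z))
  ext1
  simp only [sphereFlow, linFlow_smul, linFlow_add, norm_smul, norm_inv, norm_norm, mul_inv,
    inv_inv, smul_smul]
  congr 1
  field_simp

theorem sphereFlow_zero (a : Fin 2 → ℂ) (z : S3) : sphereFlow a 0 z = z := by
  ext1
  simp [sphereFlow, linFlow_zero]

theorem contMDiff_sphereFlow (a : Fin 2 → ℂ) :
    ContMDiff (𝓘(ℝ, ℝ).prod (𝓡 3)) (𝓡 3) ∞ fun x : ℝ × S3 => sphereFlow a x.1 x.2 := by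
  have h1 : ContMDiff (𝓘(ℝ, ℝ).prod (𝓡 3)) (𝓘(ℝ, ℝ × EuclideanSpace ℂ (Fin 2))) ∞
      fun x : ℝ × S3 => (x.1, x.2.1) :=
    contMDiff_fst.prodMk_space (contMDiff_coe_sphere.comp contMDiff_snd)
  have h2 := (contDiff_linFlow a).contMDiff.comp h1
  refine ContMDiff.codRestrict_sphere (f := fun x : ℝ × S3 =>
    ‖linFlow a x.1 x.2.1‖⁻¹ • linFlow a x.1 x.2.1) (fun x => ?_) _
  have hne : linFlow a x.1 x.2.1 ≠ 0 := linFlow_ne_zero a _ (ne_zero_of_mem_unit_sphere _)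
  have h3 : ContDiffAt ℝ ∞ (fun v : EuclideanSpace ℂ (Fin 2) => ‖v‖⁻¹ • v)
      (linFlow a x.1 x.2.1) :=
    ((contDiffAt_norm ℝ hne).inv (norm_ne_zero_iff.2 hne)).smul contDiffAt_id
  exact ContMDiffAt.comp (g := fun v : EuclideanSpace ℂ (Fin 2) => ‖v‖⁻¹ • v)
    (f := fun x : ℝ × S3 => linFlow a x.1 x.2.1) x h3.contMDiffAt (h2 x)

theorem contMDiff_sphereFlow_apply (a : Fin 2 → ℂ) (t : ℝ) :
    ContMDiff (𝓡 3) (𝓡 3) ∞ (sphereFlow a t) := by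
  have h : ContMDiff (𝓡 3) (𝓘(ℝ, ℝ).prod (𝓡 3)) ∞ fun z : S3 => (t, z) :=
    ContMDiff.prodMk (f := fun _ : S3 => t) (g := fun z : S3 => z) contMDiff_const contMDiff_id
  simpa only [Function.comp_def] using (contMDiff_sphereFlow a).comp h

/-- The flow of the sphere as a one-parameter group of diffeomorphisms. -/
noncomputable def sphereFlowDiffeo (a : Fin 2 → ℂ) (t : ℝ) : S3 ≃ₘ⟮𝓡 3, 𝓡 3⟯ S3 where
  toFun := sphereFlow a t
  invFun := sphereFlow a (-t)
  left_inv z := by rw [sphereFlow_add, neg_add_cancel, sphereFlow_zero]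
  right_inv z := by rw [sphereFlow_add, add_neg_cancel, sphereFlow_zero]
  contMDiff_toFun := contMDiff_sphereFlow_apply a t
  contMDiff_invFun := contMDiff_sphereFlow_apply a (-t)

theorem ambientIsotopic_image (a : Fin 2 → ℂ) (K : Set S3) :
    AmbientIsotopic K (sphereFlow a 1 '' K) :=
  ⟨sphereFlowDiffeo a, contMDiff_sphereFlow a, sphereFlow_zero a, rfl⟩

/-- An invariant torus knot with arbitrary radii and phases is ambient isotopic to the
standard one. -/
theorem ambientIsotopic_stdTorusKnot {α β : ℂ} (hα : α ≠ 0) (hβ : β ≠ 0)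
    (h : ‖α‖ ^ 2 + ‖β‖ ^ 2 = 1) (p q : ℤ) :
    AmbientIsotopic {z : S3 | ∃ t : ℝ, z.1 0 = α * Complex.exp (Complex.I * (q * t)) ∧
      z.1 1 = β * Complex.exp (Complex.I * (p * t))} (stdTorusKnot p q) := by
  set K := {z : S3 | ∃ t : ℝ, z.1 0 = α * Complex.exp (Complex.I * (q * t)) ∧
      z.1 1 = β * Complex.exp (Complex.I * (p * t))} with hK
  -- the flow multiplies the coordinates by `α⁻¹` and `β⁻¹` at time one, before the projection
  set a : Fin 2 → ℂ := ![-Complex.log α, -Complex.log β] with ha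
  have hnorm : ∀ x : ℝ, ‖Complex.exp (Complex.I * x)‖ = 1 := fun x => by
    rw [mul_comm, Complex.norm_exp_ofReal_mul_I]
  have key : ∀ (z : S3) (t : ℝ), z.1 0 = α * Complex.exp (Complex.I * (q * t)) →
      z.1 1 = β * Complex.exp (Complex.I * (p * t)) →
      (sphereFlow a 1 z).1 0 = Complex.exp (Complex.I * (q * t)) / (√2 : ℝ) ∧
      (sphereFlow a 1 z).1 1 = Complex.exp (Complex.I * (p * t)) / (√2 : ℝ) := by
    intro z t h0 h1
    have l0 : linFlow a 1 z.1 0 = Complex.exp (Complex.I * (q * t)) := by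
      rw [linFlow_apply, h0]
      simp [ha, Complex.exp_neg, Complex.exp_log hα, hα]
    have l1 : linFlow a 1 z.1 1 = Complex.exp (Complex.I * (p * t)) := by
      rw [linFlow_apply, h1]
      simp [ha, Complex.exp_neg, Complex.exp_log hβ, hβ]
    have hn : ‖linFlow a 1 z.1‖ = √2 := by
      rw [EuclideanSpace.norm_eq, Fin.sum_univ_two, l0, l1]
      have e0 := hnorm (q * t)
      have e1 := hnorm (p * t)
      push_cast at e0 e1
      rw [e0, e1]
      norm_num
    constructor
    · simp [sphereFlow, hn, l0]; ring
    · simp [sphereFlow, hn, l1]; ring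
  have himg : sphereFlow a 1 '' K = stdTorusKnot p q := by
    ext w
    constructor
    · rintro ⟨z, ⟨t, h0, h1⟩, rfl⟩
      exact ⟨t, key z t h0 h1⟩
    · rintro ⟨t, h0, h1⟩
      have e0 := hnorm (q * t)
      have e1 := hnorm (p * t)
      push_cast at e0 e1
      have hz : (!₂[α * Complex.exp (Complex.I * (q * t)), β * Complex.exp (Complex.I * (p * t))] :
          EuclideanSpace ℂ (Fin 2)) ∈ Metric.sphere (0 : EuclideanSpace ℂ (Fin 2)) 1 := by
        rw [mem_sphere_zero_iff_norm, EuclideanSpace.norm_eq, Fin.sum_univ_two]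
        simp [e0, e1, h]
      refine ⟨⟨_, hz⟩, ⟨t, rfl, rfl⟩, ?_⟩
      obtain ⟨k0, k1⟩ := key ⟨_, hz⟩ t rfl rfl
      ext j
      fin_cases j
      · exact k0.trans h0.symm
      · exact k1.trans h1.symm
  rw [← himg]
  exact ambientIsotopic_image a K

/-! ### The maximal torus and the standard cyclide -/

/-- The coordinates of the vector `(1, ρ, iρ²/2)` in the frame `U`. -/
noncomputable def baseCoord (ρ : ℝ) : Fin 3 → ℂ :=
  ![(2 + (ρ : ℂ) ^ 2) / (2 * (√2 : ℝ)), ρ, -Complex.I * (2 - (ρ : ℂ) ^ 2) / (2 * (√2 : ℝ))]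

theorem uMat_mulVec_baseCoord (ρ : ℝ) :
    uMat *ᵥ baseCoord ρ = ![1, (ρ : ℂ), Complex.I / 2 * (ρ : ℂ) ^ 2] := by
  have h0 := sqrt_two_ne_zero
  rw [uMat_mulVec]
  ext i
  fin_cases i
  · simp [baseCoord]
    field_simp
    rw [sqrt_two_sq, Complex.I_sq]
    ring
  · simp [baseCoord]
  · simp [baseCoord]
    field_simp
    rw [sqrt_two_sq]
    ring

theorem two_add_sq_ne_zero (ρ : ℝ) : (2 + (ρ : ℂ) ^ 2) ≠ 0 := by
  have : (2 + ρ ^ 2 : ℝ) ≠ 0 := by positivity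
  exact_mod_cast this

theorem baseCoord_zero_ne_zero (ρ : ℝ) : baseCoord ρ 0 ≠ 0 := by
  simp [baseCoord, two_add_sq_ne_zero]

/-- The first affine coordinate of the base point. -/
noncomputable def baseX (ρ : ℝ) : ℂ := baseCoord ρ 1 / baseCoord ρ 0

/-- The second affine coordinate of the base point. -/
noncomputable def baseY (ρ : ℝ) : ℂ := baseCoord ρ 2 / baseCoord ρ 0

theorem baseX_eq (ρ : ℝ) : baseX ρ = ((2 * √2 * ρ / (2 + ρ ^ 2) : ℝ) : ℂ) := by
  have h0 := sqrt_two_ne_zero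
  have h1 := two_add_sq_ne_zero ρ
  simp [baseX, baseCoord]
  field_simp

theorem baseY_eq (ρ : ℝ) :
    baseY ρ = -Complex.I * (((2 - ρ ^ 2) / (2 + ρ ^ 2) : ℝ) : ℂ) := by
  have h0 := sqrt_two_ne_zero
  have h1 := two_add_sq_ne_zero ρ
  simp [baseY, baseCoord]
  field_simp

theorem norm_baseX_sq_add (ρ : ℝ) : ‖baseX ρ‖ ^ 2 + ‖baseY ρ‖ ^ 2 = 1 := by
  rw [baseX_eq, baseY_eq, norm_mul, norm_neg, Complex.norm_I, one_mul, Complex.norm_real,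
    Complex.norm_real, Real.norm_eq_abs, Real.norm_eq_abs, sq_abs, sq_abs]
  have : (2 + ρ ^ 2 : ℝ) ≠ 0 := by positivity
  have h2 : √2 ^ 2 = 2 := Real.sq_sqrt (by norm_num)
  field_simp
  rw [h2]
  ring

theorem baseX_ne_zero {ρ : ℝ} (h : 0 < ρ) : baseX ρ ≠ 0 := by
  rw [baseX_eq, Complex.ofReal_ne_zero]
  positivity

theorem baseY_ne_zero {ρ : ℝ} (h : ρ ^ 2 < 2) : baseY ρ ≠ 0 := by
  rw [baseY_eq]
  refine mul_ne_zero (neg_ne_zero.2 Complex.I_ne_zero) (Complex.ofReal_ne_zero.2 ?_)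
  exact div_ne_zero (by linarith) (by positivity)

theorem projAct_mk (A : GL (Fin 3) ℂ) {v : Fin 3 → ℂ} (hv : v ≠ 0) :
    ∃ h, projAct A (Projectivization.mk ℂ v hv) =
      Projectivization.mk ℂ ((A : Matrix (Fin 3) (Fin 3) ℂ) *ᵥ v) h :=
  ⟨fun h => hv (Matrix.mulVec_injective_iff_isUnit.2 A.isUnit (by simpa using h)), rfl⟩

/-- The columns of `U` are common eigenvectors of the maximal torus. -/
theorem torusMat_mulVec (θ₁ θ₂ : ℝ) (a : Fin 3 → ℂ) :
    torusMat θ₁ θ₂ *ᵥ (uMat *ᵥ a) = uMat *ᵥ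
      ![Complex.exp (-(Complex.I / 6) * (θ₁ + 2 * θ₂)) * Complex.exp (θ₁ / 2 * Complex.I) * a 0,
        Complex.exp (Complex.I / 3 * (θ₁ + 2 * θ₂)) * a 1,
        Complex.exp (-(Complex.I / 6) * (θ₁ + 2 * θ₂)) * Complex.exp (-(θ₁ / 2) * Complex.I)
          * a 2] := by
  rw [uMat_mulVec, uMat_mulVec, Complex.exp_mul_I, Complex.exp_mul_I, Complex.cos_neg,
    Complex.sin_neg]
  simp only [torusMat, Complex.ofReal_cos, Complex.ofReal_sin, Complex.ofReal_div,
    Complex.ofReal_ofNat]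
  generalize Complex.exp (-(Complex.I / 6) * (θ₁ + 2 * θ₂)) = u
  generalize Complex.cos (θ₁ / 2 : ℂ) = c
  generalize Complex.sin (θ₁ / 2 : ℂ) = d
  ext i
  fin_cases i
  · simp [Matrix.mulVec, dotProduct, Fin.sum_univ_three]
    linear_combination (u * d * a 2 / (√2 : ℝ)) * Complex.I_sq
  · simp [Matrix.mulVec, dotProduct, Fin.sum_univ_three]
  · simp [Matrix.mulVec, dotProduct, Fin.sum_univ_three]
    linear_combination (-u * d * a 0 / (√2 : ℝ)) * Complex.I_sq

/-- In affine coordinates the torus acts by rotations, and the Clifford angles are the angles of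
rotation up to sign. -/
theorem projAct_torusElt (ρ θ₁ θ₂ : ℝ) :
    projAct (torusElt θ₁ θ₂) (basePoint ρ) =
      diagPoint (baseX ρ * Complex.exp (Complex.I * θ₂))
        (baseY ρ * Complex.exp (Complex.I * (-θ₁ : ℝ))) := by
  have hb := baseCoord_zero_ne_zero ρ
  obtain ⟨h, hP⟩ := projAct_mk (torusElt θ₁ θ₂) (basePoint_ne_zero ρ)
  rw [basePoint, hP, mk_uMat h ((congrArg _ (uMat_mulVec_baseCoord ρ).symm).trans
    (torusMat_mulVec θ₁ θ₂ _))]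
  · simp only [Matrix.cons_val, baseX, baseY, ← Complex.exp_add]
    congr 1
    · rw [mul_div_mul_comm, ← Complex.exp_sub, mul_comm]
      congr 2
      ring
    · rw [mul_div_mul_comm, ← Complex.exp_sub, mul_comm]
      congr 2
      push_cast
      ring
  · simp [hb, Complex.exp_ne_zero]

/-! ### Symmetrical configurations of the second kind -/

/-- The eigenvalues `e³, e², e¹` of the Hamiltonian, in decreasing order. -/
noncomputable def eigenvals (r ρ : ℝ) : Fin 3 → ℝ :=
  ![mu2 r ρ / (1 - mu2 r ρ), -(1 + r) * (mu2 r ρ / (1 - mu2 r ρ)),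
    r * (mu2 r ρ / (1 - mu2 r ρ))]

/-- The configuration is the orbit of the base point under a diagonal group. -/
theorem symmConf2_eq_mk (r ρ s : ℝ) : ∃ h,
    symmConf2 r ρ s = Projectivization.mk ℂ (diagCurve (eigenvals r ρ) (baseCoord ρ) s) h := by
  obtain ⟨h, hP⟩ := projAct_mk (uElt * expElt (s • dMat r ρ) * uElt⁻¹) (basePoint_ne_zero ρ)
  have hU : ((uElt⁻¹ : GL (Fin 3) ℂ) : Matrix (Fin 3) (Fin 3) ℂ) *ᵥ (uMat *ᵥ baseCoord ρ) =
      baseCoord ρ := by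
    rw [Matrix.mulVec_mulVec, show uMat = (uElt : Matrix (Fin 3) (Fin 3) ℂ) from rfl,
      ← Units.val_mul, inv_mul_cancel, Units.val_one, Matrix.one_mulVec]
  have hE : (expElt (s • dMat r ρ) : Matrix (Fin 3) (Fin 3) ℂ) =
      Matrix.diagonal fun j => Complex.exp (-Complex.I * eigenvals r ρ j * s) := by
    have h1 : s • dMat r ρ =
        Matrix.diagonal fun j => -Complex.I * eigenvals r ρ j * s := by
      rw [dMat, ← Matrix.diagonal_smul]
      congr 1
      ext j
      fin_cases j <;> simp [eigenvals] <;> ring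
    rw [expElt, IsUnit.unit_spec, h1, Matrix.exp_diagonal, Pi.exp_def]
    simp only [Complex.exp_eq_exp_ℂ]
  have key : ((uElt * expElt (s • dMat r ρ) * uElt⁻¹ : GL (Fin 3) ℂ) :
      Matrix (Fin 3) (Fin 3) ℂ) *ᵥ ![1, (ρ : ℂ), Complex.I / 2 * (ρ : ℂ) ^ 2] =
      diagCurve (eigenvals r ρ) (baseCoord ρ) s := by
    rw [← uMat_mulVec_baseCoord, Units.val_mul, Units.val_mul, ← Matrix.mulVec_mulVec, hU,
      ← Matrix.mulVec_mulVec, hE, diagCurve]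
    congr 1
    ext j
    rw [Matrix.mulVec_diagonal]
  refine ⟨key ▸ h, ?_⟩
  rw [symmConf2, basePoint, hP]
  simp only [key]

theorem symmConf2_eq_diagPoint (r ρ s : ℝ) :
    symmConf2 r ρ s =
      diagPoint (baseX ρ * Complex.exp (Complex.I *
          ((2 + r) * (mu2 r ρ / (1 - mu2 r ρ)) * s : ℝ)))
        (baseY ρ * Complex.exp (Complex.I *
          ((1 - r) * (mu2 r ρ / (1 - mu2 r ρ)) * s : ℝ))) := by
  obtain ⟨h, hs⟩ := symmConf2_eq_mk r ρ s
  have hb := baseCoord_zero_ne_zero ρ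
  rw [hs, mk_uMat h rfl (mul_ne_zero (Complex.exp_ne_zero _) hb), baseX, baseY,
    mul_div_mul_comm, mul_div_mul_comm, ← Complex.exp_sub, ← Complex.exp_sub]
  simp only [eigenvals, Matrix.cons_val]
  generalize mu2 r ρ / (1 - mu2 r ρ) = m
  rw [mul_comm (baseCoord ρ 1 / _), mul_comm (baseCoord ρ 2 / _)]
  congr 3 <;> push_cast <;> ring

theorem normSq_baseCoord_zero (ρ : ℝ) : Complex.normSq (baseCoord ρ 0) = (2 + ρ ^ 2) ^ 2 / 8 := by
  have h : baseCoord ρ 0 = (((2 + ρ ^ 2) / (2 * √2) : ℝ) : ℂ) := by simp [baseCoord]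
  rw [h, Complex.normSq_ofReal, ← sq, div_pow, mul_pow, Real.sq_sqrt zero_le_two]
  norm_num

theorem normSq_baseCoord_one (ρ : ℝ) : Complex.normSq (baseCoord ρ 1) = ρ ^ 2 := by
  simp [baseCoord, Complex.normSq_ofReal, sq]

theorem normSq_baseCoord_two (ρ : ℝ) : Complex.normSq (baseCoord ρ 2) = (2 - ρ ^ 2) ^ 2 / 8 := by
  have h : baseCoord ρ 2 = -Complex.I * (((2 - ρ ^ 2) / (2 * √2) : ℝ) : ℂ) := by
    simp [baseCoord]; ring
  rw [h, map_mul, Complex.normSq_neg, Complex.normSq_I, one_mul, Complex.normSq_ofReal, ← sq,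
    div_pow, mul_pow, Real.sq_sqrt zero_le_two]
  norm_num

theorem baseCoord_prod (ρ : ℝ) :
    baseCoord ρ 0 * baseCoord ρ 1 * baseCoord ρ 2 = -Complex.I * (ρ * (4 - ρ ^ 4) / 8) := by
  have h0 := sqrt_two_ne_zero
  simp only [baseCoord, Matrix.cons_val]
  field_simp
  rw [sqrt_two_sq]
  ring

theorem diagCurve_smul (e : Fin 3 → ℝ) (c : ℂ) (w : Fin 3 → ℂ) (s : ℝ) :
    diagCurve e (c • w) s = c • diagCurve e w s := by
  rw [diagCurve, diagCurve, ← Matrix.mulVec_smul]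
  congr 1
  ext j
  simp only [Pi.smul_apply, smul_eq_mul]
  ring

/-- The numerator of `μ₂` is negative: it is affine in `r`, and nonpositive at both ends of the
interval, where it equals `-3 (ρ² - 2)²` and `-(6 + 6ρ² + 3ρ⁴/2)`. -/
theorem mu2_num_neg {r : ℝ} (hr₁ : -2 < r) (hr₂ : r < -1 / 2) (ρ : ℝ) :
    -4 + 4 * r - 12 * ρ ^ 2 * (1 + r) + (r - 1) * ρ ^ 4 < 0 := by
  nlinarith [mul_nonneg (by linarith : 0 ≤ -1 / 2 - r) (sq_nonneg (ρ ^ 2 - 2)),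
    mul_nonneg (by linarith : 0 ≤ r + 2) (sq_nonneg ρ),
    mul_nonneg (by linarith : 0 ≤ r + 2) (sq_nonneg (ρ ^ 2))]

/-- The scale `m = μ₂ / (1 - μ₂)` of the spectrum equals `-N / (2 a²)`, where `N` is the numerator
of `μ₂` and `a` the cube root of the base of the real power in `μ₂`. That base is positive, so the
real power is the honest one. -/
theorem exists_scale {r ρ : ℝ} (hr₁ : -2 < r) (hr₂ : r < -1 / 2) (hρ₁ : 0 < ρ)
    (hρ₂ : ρ ^ 2 < 2) :
    ∃ a m : ℝ, 0 < a ∧ 0 < m ∧ mu2 r ρ / (1 - mu2 r ρ) = m ∧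
      a ^ 3 = (2 + 3 * r - 3 * r ^ 2 - 2 * r ^ 3) * (-4 * ρ + ρ ^ 5) ∧
      -4 + 4 * r - 12 * ρ ^ 2 * (1 + r) + (r - 1) * ρ ^ 4 = -(2 * m * a ^ 2) := by
  have hN := mu2_num_neg hr₁ hr₂ ρ
  set N := -4 + 4 * r - 12 * ρ ^ 2 * (1 + r) + (r - 1) * ρ ^ 4 with hNdef
  set A := (2 + 3 * r - 3 * r ^ 2 - 2 * r ^ 3) * (-4 * ρ + ρ ^ 5) with hA
  have hApos : 0 < A := by
    have h1 : A = (1 - r) * (2 + r) * (-(1 + 2 * r)) * (ρ * (2 + ρ ^ 2) * (2 - ρ ^ 2)) := by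
      rw [hA]; ring
    rw [h1]
    have := sub_pos.2 hρ₂
    have h2 : 0 < 1 - r := by linarith
    have h3 : 0 < 2 + r := by linarith
    have h4 : 0 < -(1 + 2 * r) := by linarith
    positivity
  have ha : 0 < A ^ (1 / 3 : ℝ) := Real.rpow_pos_of_pos hApos _
  have ha3 : (A ^ (1 / 3 : ℝ)) ^ 3 = A := by
    rw [← Real.rpow_natCast, ← Real.rpow_mul hApos.le]
    norm_num
  have ha2 : A ^ (2 / 3 : ℝ) = (A ^ (1 / 3 : ℝ)) ^ 2 := by
    rw [← Real.rpow_natCast, ← Real.rpow_mul hApos.le]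
    norm_num
  have hmu : mu2 r ρ = N / (N - 2 * A ^ (2 / 3 : ℝ)) := rfl
  generalize A ^ (1 / 3 : ℝ) = a at *
  have hd : N - 2 * a ^ 2 ≠ 0 := by nlinarith [sq_nonneg a]
  refine ⟨a, -N / (2 * a ^ 2), ha, div_pos (by linarith) (by positivity), ?_, ha3, ?_⟩
  · have h1 : 1 - mu2 r ρ = -(2 * a ^ 2) / (N - 2 * a ^ 2) := by
      rw [hmu, ha2]
      field_simp
      ring
    rw [h1, hmu, ha2, div_div_div_cancel_right₀ hd, div_neg, neg_div]
  · field_simp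

/-- Multiplied by `c = 2 / (m a)`, the orbit of the base point is a Wilczynski lift with
`⟨Γ, Γ'⟩ = i`. -/
theorem isoparametric_symmConf2 {r ρ : ℝ} (hr₁ : -2 < r) (hr₂ : r < -1 / 2) (hρ₁ : 0 < ρ)
    (hρ₂ : ρ ^ 2 < 2) :
    ∃ κ τ : ℝ, IsIsoparametric (symmConf2 r ρ) κ τ ∧ (κ, τ) ∈ regionMinus ∧
      HasSpectralRatio κ τ r := by
  obtain ⟨a, m, ha, hm, hmu, ha3, hN⟩ := exists_scale hr₁ hr₂ hρ₁ hρ₂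
  -- the factor that turns the orbit of the base point into a Wilczynski lift
  obtain ⟨c, hc⟩ : ∃ c : ℝ, c * m * a = 2 := ⟨2 / (m * a), by field_simp⟩
  have hc0 : c ≠ 0 := by rintro rfl; simp at hc
  set e := eigenvals r ρ with he_def
  have e0 : e 0 = m := hmu
  have e1 : e 1 = -(1 + r) * m := by rw [← hmu]; rfl
  have e2 : e 2 = r * m := by rw [← hmu]; rfl
  set w : Fin 3 → ℂ := (c : ℂ) • baseCoord ρ with hw
  obtain ⟨p₁, hp₁⟩ : ∃ x, x = c ^ 2 * ((2 - ρ ^ 2) ^ 2 / 8) := ⟨_, rfl⟩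
  obtain ⟨p₂, hp₂⟩ : ∃ x, x = c ^ 2 * ρ ^ 2 := ⟨_, rfl⟩
  obtain ⟨p₃, hp₃⟩ : ∃ x, x = -(c ^ 2 * ((2 + ρ ^ 2) ^ 2 / 8)) := ⟨_, rfl⟩
  have hmom : ∀ n, moment e w n = (r * m) ^ n * p₁ + (-(1 + r) * m) ^ n * p₂ + m ^ n * p₃ := by
    intro n
    simp only [moment, hw, Pi.smul_apply, smul_eq_mul, map_mul, Complex.normSq_ofReal,
      normSq_baseCoord_zero, normSq_baseCoord_one, normSq_baseCoord_two, e0, e1, e2, hp₁, hp₂, hp₃]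
    ring
  have hesum : r * m + -(1 + r) * m + m = 0 := by ring
  have h0 : p₁ + p₂ + p₃ = 0 := by rw [hp₁, hp₂, hp₃]; ring
  have h1 : r * m * p₁ + -(1 + r) * m * p₂ + m * p₃ = -1 := by
    rw [hp₁, hp₂, hp₃]
    linear_combination (c ^ 2 * m / 8) * hN - ((c * m * a + 2) / 4) * hc
  have hca : (c * m) ^ 3 * ((2 + 3 * r - 3 * r ^ 2 - 2 * r ^ 3) * (-4 * ρ + ρ ^ 5)) = 8 := by
    rw [← ha3, ← mul_pow, hc]; norm_num
  have hG : p₁ * p₂ * p₃ *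
      ((-(1 + r) * m - r * m) * (m - r * m) * (m - -(1 + r) * m)) ^ 2 = -1 := by
    rw [hp₁, hp₂, hp₃]
    linear_combination (-((c * m) ^ 3 *
      ((2 + 3 * r - 3 * r ^ 2 - 2 * r ^ 3) * (-4 * ρ + ρ ^ 5)) + 8) / 64) * hca
  have hW : Complex.I * (w 0 * w 1 * w 2) * ((e 1 - e 0) * (e 2 - e 0) * (e 2 - e 1)) = -1 := by
    have hp : w 0 * w 1 * w 2 = c ^ 3 * (-Complex.I * (ρ * (4 - ρ ^ 4) / 8)) := by
      rw [← baseCoord_prod]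
      simp only [hw, Pi.smul_apply, smul_eq_mul]
      ring
    have hca' : ((c : ℂ) * m) ^ 3 * ((2 + 3 * r - 3 * r ^ 2 - 2 * r ^ 3) * (-4 * ρ + ρ ^ 5)) = 8 :=
      mod_cast hca
    rw [hp, e0, e1, e2]
    push_cast
    linear_combination (-1 / 8 : ℂ) * hca' - (c ^ 3 * (ρ * (4 - ρ ^ 4) / 8) *
      ((-(1 + r) * m - m) * (r * m - m) * (r * m - -(1 + r) * m)) : ℂ) * Complex.I_sq
  have hlift : ∀ s, ∃ h : diagCurve e w s ≠ 0,
      symmConf2 r ρ s = Projectivization.mk ℂ (diagCurve e w s) h := by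
    intro s
    obtain ⟨h, hs⟩ := symmConf2_eq_mk r ρ s
    have hsm : diagCurve e w s = (c : ℂ) • diagCurve e (baseCoord ρ) s := diagCurve_smul ..
    have hc' : (c : ℂ) ≠ 0 := Complex.ofReal_ne_zero.2 hc0
    refine ⟨hsm ▸ smul_ne_zero hc' h, ?_⟩
    rw [hs, Projectivization.mk_eq_mk_iff']
    exact ⟨(c : ℂ)⁻¹, by rw [hsm, inv_smul_smul₀ hc']⟩
  have hiso := isIsoparametric_of_moment (by rw [e0, e1, e2]; ring) hlift
    (by rw [hmom]; simpa using h0) (by rw [hmom]; simpa using h1) hW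
  generalize hκ : moment e w 2 / 2 = κ at hiso
  generalize hτ : moment e w 3 + 3 * κ ^ 2 = τ at hiso
  have h2 : (r * m) ^ 2 * p₁ + (-(1 + r) * m) ^ 2 * p₂ + m ^ 2 * p₃ = 2 * κ := by
    rw [← hmom, ← hκ]; ring
  have h3 : (r * m) ^ 3 * p₁ + (-(1 + r) * m) ^ 3 * p₂ + m ^ 3 * p₃ = τ - 3 * κ ^ 2 := by
    rw [← hmom, ← hτ]; ring
  obtain ⟨hσ₂, hσ₃⟩ := symmetric_functions hesum h0 h1 h2 h3 hG
  have h12 : r * m < -(1 + r) * m := by gcongr; linarith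
  have h23 : -(1 + r) * m < m := by nlinarith
  refine ⟨κ, τ, hiso, ?_, r * m, -(1 + r) * m, m, h12, h23, ?_, ?_⟩
  · exact mem_regionMinus hesum h12 h23 (by rw [hp₂]; positivity) h0 h1 h2 hσ₂ hσ₃
  · rw [hamiltonian_charpoly hesum hσ₂ hσ₃, Polynomial.roots_multiset_prod_X_sub_C]
  · field_simp

/-! ### The trajectory -/

/-- Coprime frequencies: if both `exp(i p φ)` and `exp(i q φ)` take the same value at two
parameters, these differ by a multiple of `2π`. -/
theorem exists_int_of_exp_eq {p q : ℤ} (h : IsCoprime p q) {φ ψ : ℝ}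
    (hp : Complex.exp (Complex.I * (p * φ : ℝ)) = Complex.exp (Complex.I * (p * ψ : ℝ)))
    (hq : Complex.exp (Complex.I * (q * φ : ℝ)) = Complex.exp (Complex.I * (q * ψ : ℝ))) :
    ∃ n : ℤ, φ = ψ + n * (2 * Real.pi) := by
  have aux : ∀ x y : ℝ, Complex.exp (Complex.I * x) = Complex.exp (Complex.I * y) →
      ∃ n : ℤ, x = y + n * (2 * Real.pi) := by
    intro x y hxy
    obtain ⟨n, hn⟩ := Complex.exp_eq_exp_iff_exists_int.1 hxy
    refine ⟨n, Complex.ofReal_injective (mul_left_cancel₀ Complex.I_ne_zero ?_)⟩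
    push_cast
    linear_combination hn
  obtain ⟨n₁, h₁⟩ := aux _ _ hp
  obtain ⟨n₂, h₂⟩ := aux _ _ hq
  obtain ⟨u, v, huv⟩ := h
  have huv' : (u : ℝ) * p + v * q = 1 := by exact_mod_cast huv
  refine ⟨u * n₁ + v * n₂, ?_⟩
  push_cast
  linear_combination (u : ℝ) * h₁ + v * h₂ - (φ - ψ) * huv'

theorem isSimpleClosed_of_torus {x y : ℂ} (hx : x ≠ 0) (hy : y ≠ 0) {p q : ℤ}
    (h : IsCoprime p q) {k : ℝ} (hk : 0 < k) :
    IsSimpleClosed fun s : ℝ => diagPoint (x * Complex.exp (Complex.I * (p * (k * s) : ℝ)))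
      (y * Complex.exp (Complex.I * (q * (k * s) : ℝ))) := by
  have hper : ∀ (n : ℤ) (s : ℝ), Complex.exp (Complex.I * (n * (k * (s + 2 * Real.pi / k)) : ℝ)) =
      Complex.exp (Complex.I * (n * (k * s) : ℝ)) := by
    intro n s
    refine Complex.exp_eq_exp_iff_exists_int.2 ⟨n, ?_⟩
    have : k * (s + 2 * Real.pi / k) = k * s + 2 * Real.pi := by field_simp
    rw [this]
    push_cast
    ring
  refine ⟨2 * Real.pi / k, by positivity, fun s => ?_, fun s hs t ht hst => ?_⟩
  · simp only [hper]
  · obtain ⟨h1, h2⟩ := diagPoint_inj.1 hst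
    obtain ⟨n, hn⟩ := exists_int_of_exp_eq h (mul_left_cancel₀ hx h1) (mul_left_cancel₀ hy h2)
    have hs2 : k * s < 2 * Real.pi := by
      have := (lt_div_iff₀ hk).1 hs.2; linarith
    have ht2 : k * t < 2 * Real.pi := by
      have := (lt_div_iff₀ hk).1 ht.2; linarith
    have hs1 : 0 ≤ k * s := mul_nonneg hk.le hs.1
    have ht1 : 0 ≤ k * t := mul_nonneg hk.le ht.1
    have hπ := Real.two_pi_pos
    have hn1 : (n : ℝ) < 1 := by nlinarith
    have hn2 : (-1 : ℝ) < n := by nlinarith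
    have hn0 : n = 0 := by
      have h3 : n < 1 := by exact_mod_cast hn1
      have h4 : -1 < n := by exact_mod_cast hn2
      omega
    rw [hn0] at hn
    exact mul_left_cancel₀ hk.ne' (by simpa using hn)

/-- If the frequencies of the configuration are commensurable, it is the closed curve of type
`(p, q)` on the cyclide, run through at the constant speed `k`. -/
theorem symmConf2_eq_torus {r ρ k : ℝ} {p q : ℤ}
    (hp : (2 + r) * (mu2 r ρ / (1 - mu2 r ρ)) = p * k)
    (hq : (1 - r) * (mu2 r ρ / (1 - mu2 r ρ)) = q * k) (s : ℝ) :
    symmConf2 r ρ s = diagPoint (baseX ρ * Complex.exp (Complex.I * (p * (k * s) : ℝ)))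
      (baseY ρ * Complex.exp (Complex.I * (q * (k * s) : ℝ))) := by
  rw [symmConf2_eq_diagPoint, hp, hq, mul_assoc, mul_assoc]

theorem cyclideCurve_eq (ρ : ℝ) (p q : ℤ) :
    cyclideCurve ρ p q = Set.range fun φ : ℝ =>
      diagPoint (baseX ρ * Complex.exp (Complex.I * (p * φ : ℝ)))
        (baseY ρ * Complex.exp (Complex.I * (q * φ : ℝ))) := by
  ext P
  simp only [cyclideCurve, Set.mem_ofPred_eq, Set.mem_range, projAct_torusElt, neg_neg, eq_comm]

theorem cyclideCurve_subset_cyclide (ρ : ℝ) (p q : ℤ) : cyclideCurve ρ p q ⊆ cyclide ρ := by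
  rintro P ⟨φ, rfl⟩
  exact ⟨_, _, rfl⟩

theorem cyclideCurve_subset_crSphere (ρ : ℝ) (p q : ℤ) : cyclideCurve ρ p q ⊆ crSphere := by
  rw [cyclideCurve_eq]
  rintro _ ⟨φ, rfl⟩
  rw [diagPoint_mem_crSphere, norm_mul, norm_mul, mul_comm Complex.I, mul_comm Complex.I,
    Complex.norm_exp_ofReal_mul_I, Complex.norm_exp_ofReal_mul_I, mul_one, mul_one,
    norm_baseX_sq_add]

theorem isPositiveTorusKnot_cyclideCurve {ρ : ℝ} (hρ₁ : 0 < ρ) (hρ₂ : ρ ^ 2 < 2) {p q : ℤ}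
    (hp : 0 < p) (hq : 0 < q) (h : IsCoprime p q) :
    IsPositiveTorusKnot p q (cyclideCurve ρ p q) := by
  refine ⟨hp, hq, h, cyclideCurve_subset_crSphere ρ p q, ?_⟩
  have hI := Complex.I_ne_zero
  have hα : Complex.I * baseY ρ ≠ 0 := mul_ne_zero hI (baseY_ne_zero hρ₂)
  have hβ : -Complex.I * baseX ρ ≠ 0 := mul_ne_zero (neg_ne_zero.2 hI) (baseX_ne_zero hρ₁)
  have hn : ‖Complex.I * baseY ρ‖ ^ 2 + ‖-Complex.I * baseX ρ‖ ^ 2 = 1 := by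
    rw [norm_mul, norm_mul, norm_neg, Complex.norm_I, one_mul, one_mul, add_comm,
      norm_baseX_sq_add]
  convert ambientIsotopic_stdTorusKnot hα hβ hn p q using 1
  ext z
  rw [cyclideCurve_eq]
  simp only [Set.mem_preimage, Set.mem_range, sphereMap_eq, diagPoint_inj, Set.mem_ofPred_eq]
  push_cast
  refine exists_congr fun φ => ?_
  constructor
  · rintro ⟨h1, h2⟩
    constructor
    · linear_combination (-Complex.I) * h2 + z.1 0 * Complex.I_sq
    · linear_combination Complex.I * h1 + z.1 1 * Complex.I_sq
  · rintro ⟨h1, h2⟩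
    constructor
    · linear_combination (-Complex.I) * h2
        + baseX ρ * Complex.exp (Complex.I * (p * φ)) * Complex.I_sq
    · linear_combination Complex.I * h1
        + baseY ρ * Complex.exp (Complex.I * (q * φ)) * Complex.I_sq

end CRKnot

theorem proposition3p4p2 (r : ℚ) (ρ : ℝ) (hr₁ : -2 < r) (hr₂ : r < -1 / 2)
    (hρ₁ : 0 < ρ) (hρ₂ : ρ < √2) :
    (∃ κ τ : ℝ, CRKnot.IsIsoparametricKnot (CRKnot.symmConf2 r ρ) κ τ ∧
      (κ, τ) ∈ CRKnot.regionMinus ∧ CRKnot.HasSpectralRatio κ τ r) ∧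
    CRKnot.IsPositiveTorusKnot ((2 + r) / (1 - r)).num ((2 + r) / (1 - r)).den
      (Set.range (CRKnot.symmConf2 r ρ)) ∧
    Set.range (CRKnot.symmConf2 r ρ) ⊆ CRKnot.cyclide ρ ∧
    Set.range (CRKnot.symmConf2 r ρ) =
      CRKnot.cyclideCurve ρ ((2 + r) / (1 - r)).num ((2 + r) / (1 - r)).den := by
  have hρ : ρ ^ 2 < 2 := (Real.lt_sqrt hρ₁.le).1 hρ₂
  have hr₁' : (-2 : ℝ) < r := by exact_mod_cast hr₁
  have hr₂' : (r : ℝ) < -1 / 2 := by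
    have : ((r : ℚ) : ℝ) < ((-1 / 2 : ℚ) : ℝ) := Rat.cast_lt.2 hr₂
    push_cast at this
    exact this
  set x : ℚ := (2 + r) / (1 - r) with hx
  have hxpos : 0 < x := div_pos (by linarith) (by linarith)
  have hnum : 0 < x.num := Rat.num_pos.2 hxpos
  have hden : (0 : ℤ) < x.den := by exact_mod_cast x.den_pos
  have hcop : IsCoprime x.num (x.den : ℤ) := Rat.isCoprime_num_den x
  obtain ⟨a, m, -, hm, hmu, -, -⟩ := CRKnot.exists_scale hr₁' hr₂' hρ₁ hρ
  have hq0 : ((x.den : ℤ) : ℝ) ≠ 0 := by exact_mod_cast hden.ne'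
  have h1r : 0 < 1 - (r : ℝ) := by linarith
  -- the angular speed of the parameter `φ` of the closed curve on the cyclide
  obtain ⟨k, hk⟩ : ∃ k : ℝ, k = (1 - r) * m / (x.den : ℤ) := ⟨_, rfl⟩
  have hkpos : 0 < k := by
    rw [hk]
    exact div_pos (mul_pos h1r hm) (by exact_mod_cast hden)
  have hq : (1 - (r : ℝ)) * (CRKnot.mu2 r ρ / (1 - CRKnot.mu2 r ρ)) = (x.den : ℤ) * k := by
    rw [hmu, hk]
    field_simp
  have hp : (2 + (r : ℝ)) * (CRKnot.mu2 r ρ / (1 - CRKnot.mu2 r ρ)) = x.num * k := by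
    have hxr : (x.num : ℝ) / (x.den : ℤ) = (2 + r) / (1 - r) := by
      have : ((x : ℚ) : ℝ) = (2 + r) / (1 - r) := by rw [hx]; push_cast; rfl
      rw [← this, Rat.cast_def]
      norm_cast
    rw [div_eq_div_iff hq0 h1r.ne'] at hxr
    rw [hmu, hk]
    field_simp
    linear_combination -hxr
  have hcurve := CRKnot.symmConf2_eq_torus hp hq
  have hrange : Set.range (CRKnot.symmConf2 r ρ) = CRKnot.cyclideCurve ρ x.num x.den := by
    rw [CRKnot.cyclideCurve_eq, funext hcurve]
    exact (mul_left_surjective₀ hkpos.ne').range_comp fun φ : ℝ =>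
      CRKnot.diagPoint (CRKnot.baseX ρ * Complex.exp (Complex.I * (x.num * φ : ℝ)))
        (CRKnot.baseY ρ * Complex.exp (Complex.I * ((x.den : ℤ) * φ : ℝ)))
  refine ⟨?_, ?_, ?_, hrange⟩
  · obtain ⟨κ, τ, hiso, hreg, hspec⟩ := CRKnot.isoparametric_symmConf2 hr₁' hr₂' hρ₁ hρ
    refine ⟨κ, τ, ⟨hiso, ?_⟩, hreg, hspec⟩
    rw [funext hcurve]
    exact CRKnot.isSimpleClosed_of_torus (CRKnot.baseX_ne_zero hρ₁) (CRKnot.baseY_ne_zero hρ)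
      hcop hkpos
  · rw [hrange]
    exact CRKnot.isPositiveTorusKnot_cyclideCurve hρ₁ hρ hnum hden hcop
  · rw [hrange]
    exact CRKnot.cyclideCurve_subset_cyclide ρ _ _
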